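/- Let $\varphi$ be any acceptable programming system for the partial computable functions $\mathbb{N}\rightharpoonup\mathbb{N}$ (that is, $(e,x)\mapsto\varphi_e(x)$ is partial computable, and for every partial computable $\psi(e,x)$ there is a total computable $t$ with $\varphi_{t(e)}=\psi(e,\cdot)$ for all $e$), and let $W_e=\mathrm{dom}(\varphi_e)$. A *text* is a total function $T:\mathbb{N}\to\mathbb{N}\cup\{\#\}$. We write $\mathrm{content}(T)=\mathrm{range}(T)\setminus\{\#\}$ and $T[i]$ for the finite sequence $T(0),\dots,T(i-1)$; $T$ is a text *for* $L\subseteq\mathbb{N}$ if $\mathrm{content}(T)=L$. A *learner* is a partial computable function $h$ from finite sequences over $\mathbb{N}\cup\{\#\}$ to $\mathbb{N}$. A class $\mathcal{L}$ of subsets of $\mathbb{N}$ is - *$\mathbf{TxtGEx}$-learnable* if there is a learner $h$ such that, for every $L\in\mathcal{L}$ and every text $T$ for $L$, $h(T[i])$ is defined for all $i$, and there is $n_0$ with $h(T[n])=h(T[n_0])$ for all $n\ge n_0$ and $W_{h(T[n_0])}=L$; - *$\mathbf{TxtGSDecEx}$-learnable* (strongly decisively learnable) if there is a learner $h$ with the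 above property such that, in addition, for every $L\in\mathcal{L}$, every text $T$ for $L$ and all $i\le j\le k$, if $W_{h(T[i])}=W_{h(T[k])}$ then $h(T[j])=h(T[i])$. **Theorem.** If $\mathbb{N}\in\mathcal{L}$ and $\mathcal{L}$ is $\mathbf{TxtGEx}$-learnable, then $\mathcal{L}$ is $\mathbf{TxtGSDecEx}$-learnable. -/

import Mathlib

namespace InductiveInference

/-- An acceptable programming system for the partial computable functions `ℕ ⇀ ℕ`: the two-place
function `(e, x) ↦ φ e x` is partial computable, and programs of any partial computable two-place
function `ψ` (the first argument being the parameter) can be computably translated into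
`φ`-programs. -/
def IsAcceptable (φ : ℕ → ℕ →. ℕ) : Prop :=
  Partrec₂ φ ∧
    ∀ ψ : ℕ → ℕ →. ℕ, Partrec₂ ψ → ∃ t : ℕ → ℕ, Computable t ∧ ∀ e, φ (t e) = ψ e

/-- `W φ e` is the domain of the partial function computed by the `φ`-program `e`. -/
def W (φ : ℕ → ℕ →. ℕ) (e : ℕ) : Set ℕ := {x | (φ e x).Dom}

/-- A text is a total function from `ℕ` to `ℕ ∪ {#}`; the pause symbol `#` is `none`. -/
abbrev Text := ℕ → Option ℕ

/-- The set of data (without pauses) occurring in a text. -/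
def Text.content (T : Text) : Set ℕ := {x | ∃ n, T n = some x}

/-- The initial segment `T[n] = T(0), …, T(n - 1)`. -/
def Text.initSeg (T : Text) (n : ℕ) : List (Option ℕ) := (List.range n).map T

/-- Partial functions on finite sequences over `ℕ ∪ {#}`; the (admissible) learners are the
partial computable ones. -/
abbrev SeqFun := List (Option ℕ) →. ℕ

/-- The interaction operator of full-information learning: `G(h, T)(i) = h(T[i])`. -/
def G (h : SeqFun) (T : Text) : ℕ →. ℕ := fun i => h (T.initSeg i)

/-- A learning restriction is a predicate on (possibly partial) learning sequences and texts. -/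
abbrev Restriction := (ℕ →. ℕ) → Text → Prop

/-- Explanatory learning: the learning sequence is total and converges to a single correct index. -/
def Ex (φ : ℕ → ℕ →. ℕ) : Restriction := fun p T =>
  ∃ q : ℕ → ℕ, (∀ i, p i = Part.some (q i)) ∧
    ∃ n₀, ∀ n ≥ n₀, q n = q n₀ ∧ W φ (q n₀) = T.content

/-- Strong decisiveness: the learning sequence is total and never semantically returns to a
syntactically abandoned conjecture. -/
def SDec (φ : ℕ → ℕ →. ℕ) : Restriction := fun p _T =>
  ∃ q : ℕ → ℕ, (∀ i, p i = Part.some (q i)) ∧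
    ∀ i j k, i ≤ j → j ≤ k → W φ (q i) = W φ (q k) → q j = q i

/-- `SDecEx`: the combination of strong decisiveness and explanatory learning. -/
def SDecEx (φ : ℕ → ℕ →. ℕ) : Restriction := fun p T => SDec φ p T ∧ Ex φ p T

/-- `h` `TxtGδ`-learns the language `L`: `δ` holds on every text for `L`. -/
def TxtGLearns (δ : Restriction) (h : SeqFun) (L : Set ℕ) : Prop :=
  ∀ T : Text, T.content = L → δ (G h T) T

/-- The class `ℒ` is `TxtGδ`-learnable: one partial computable learner learns all its members. -/
def TxtGLearnable (δ : Restriction) (ℒ : Set (Set ℕ)) : Prop :=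
  ∃ h : SeqFun, Partrec h ∧ ∀ L ∈ ℒ, TxtGLearns δ h L

end InductiveInference

/-! A learner of `ℕ` is total, as every finite sequence begins a text for `ℕ`, and it has a locking
sequence `σ₀` on `ℕ`. By locking, the only member of the class that contains the data of `σ₀` is
`ℕ`. The new learner therefore conjectures `h σ₀` for good once it has seen these data.

Before that it conjectures `p σ`, where `σ` is the current approximation to a locking sequence
(`exists_lockSeq_locking`). The program `p σ` enumerates the data of `σ` together with the set of `h
σ`. If the enumeration covers `σ₀`, or yields some `ρ` after which `h` changes its mind on `σ`, the
set is spoiled: it becomes a finite initial segment that contains `σ₀` and encodes `σ`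
(`exists_conjectures`).

No abandoned set returns. Spoiled sets determine `σ`; unspoiled ones miss a datum of `σ₀`, so they
are not spoiled ones, and neither kind is `ℕ`. If two successive approximations had equal unspoiled
sets, the later one would contain the data refuting the earlier (`exists_refutation`), which would
then be spoiled. -/

namespace InductiveInference

/-! ### Initial segments of texts -/

namespace Text

@[simp] theorem length_initSeg (T : Text) (n : ℕ) : (T.initSeg n).length = n := by
  simp [initSeg]

theorem mem_initSeg {T : Text} {n : ℕ} {a : Option ℕ} : a ∈ T.initSeg n ↔ ∃ i < n, T i = a := by
  simp [initSeg]

theorem mem_content_of_mem_initSeg {T : Text} {n x : ℕ} (h : some x ∈ T.initSeg n) :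
    x ∈ T.content := by
  obtain ⟨i, -, hi⟩ := mem_initSeg.1 h
  exact ⟨i, hi⟩

theorem take_initSeg (T : Text) {m n : ℕ} (h : m ≤ n) : (T.initSeg n).take m = T.initSeg m := by
  simp [initSeg, ← List.map_take, List.take_range, h]

/-- The text that starts with the finite sequence `σ` and continues with `T`. -/
def prepend (σ : List (Option ℕ)) (T : Text) : Text := fun n => (σ[n]?).getD (T (n - σ.length))

theorem initSeg_prepend (σ : List (Option ℕ)) (T : Text) (k : ℕ) :
    (prepend σ T).initSeg (σ.length + k) = σ ++ T.initSeg k := by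
  apply List.ext_getElem
  · simp
  · intro i h₁ h₂
    rw [List.getElem_append]
    split_ifs with hi
    · simp [initSeg, prepend, hi]
    · simp [initSeg, prepend, List.getElem?_eq_none (not_lt.1 hi)]

theorem initSeg_prepend_length (σ : List (Option ℕ)) (T : Text) :
    (prepend σ T).initSeg σ.length = σ := by
  simpa [initSeg] using initSeg_prepend σ T 0

theorem content_prepend {σ : List (Option ℕ)} {T : Text}
    (h : ∀ x, some x ∈ σ → x ∈ T.content) : (prepend σ T).content = T.content := by
  ext x
  constructor
  · rintro ⟨n, hn⟩
    by_cases hl : n < σ.length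
    · exact h x (by rw [← hn]; simp [prepend, hl])
    · exact ⟨n - σ.length, by simpa [prepend, List.getElem?_eq_none (not_lt.1 hl)] using hn⟩
  · rintro ⟨n, hn⟩
    exact ⟨σ.length + n, by simpa [prepend] using hn⟩

end Text

/-! ### Searching for locking sequences -/

/-- Every datum of `ρ` occurs in `l`. -/
def Covered (ρ l : List (Option ℕ)) : Prop := ∀ a ∈ ρ, a = none ∨ a ∈ l

instance : DecidableRel Covered := fun ρ l =>
  inferInstanceAs (Decidable (∀ a ∈ ρ, a = none ∨ a ∈ l))

theorem covered_iff {ρ l : List (Option ℕ)} : Covered ρ l ↔ ∀ x, some x ∈ ρ → some x ∈ l := by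
  constructor
  · intro h x hx
    simpa using h _ hx
  · rintro h (_ | x) hx
    · exact Or.inl rfl
    · exact Or.inr (h x hx)

theorem eventually_covered {A : ℕ → List (Option ℕ)}
    (hA : ∀ s t, s ≤ t → ∀ x, some x ∈ A s → some x ∈ A t) {ρ : List (Option ℕ)}
    (hρ : ∀ x, some x ∈ ρ → ∃ s, some x ∈ A s) : ∃ s₀, ∀ s ≥ s₀, Covered ρ (A s) := by
  have key : ∀ a ∈ ρ, ∀ᶠ s in Filter.atTop, a = none ∨ a ∈ A s := by
    rintro (_ | x) hx
    · simp
    · obtain ⟨s, hs⟩ := hρ x hx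
      filter_upwards [Filter.eventually_ge_atTop s] with t ht
      exact Or.inr (hA s t ht x hs)
  have : ∀ᶠ s in Filter.atTop, ∀ a ∈ ρ.toFinset, a = none ∨ a ∈ A s :=
    (Filter.eventually_all_finset _).2 fun a ha => key a (List.mem_toFinset.1 ha)
  obtain ⟨s₀, h⟩ := Filter.eventually_atTop.1 this
  exact ⟨s₀, fun s hs a ha => h s hs a (List.mem_toFinset.2 ha)⟩

/-- An enumeration of all finite sequences in which each one occurs infinitely often. -/
def candidate (n : ℕ) : List (Option ℕ) := (Encodable.decode n.unpair.1).getD []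

theorem exists_candidate_eq (ρ : List (Option ℕ)) (n₀ : ℕ) : ∃ n ≥ n₀, candidate n = ρ :=
  ⟨Nat.pair (Encodable.encode ρ) n₀, Nat.right_le_pair _ _, by simp [candidate]⟩

section Search

variable (h : List (Option ℕ) → ℕ)

/-- The candidate number `n` is covered by `l` and makes `h` change its mind after `σ`. -/
def Refutes (n : ℕ) (σ l : List (Option ℕ)) : Prop :=
  Covered (candidate n) l ∧ h (σ ++ candidate n) ≠ h σ

instance (n : ℕ) (σ l : List (Option ℕ)) : Decidable (Refutes h n σ l) :=
  inferInstanceAs (Decidable (_ ∧ _))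

/-- The `n`-th approximation, based on the data in `l`, to a locking sequence of `h`. -/
def lockApprox (l : List (Option ℕ)) : ℕ → List (Option ℕ)
  | 0 => []
  | n + 1 =>
    if Refutes h n (lockApprox l n) (l.take (n + 1)) then
      -- Copying the data seen so far ensures that a search that never settles builds a text for the
      -- whole language.
      lockApprox l n ++ (candidate n ++ l.take (n + 1))
    else lockApprox l n

/-- The approximation to a locking sequence after `n` data of the text `T`. -/
def lockSeq (T : Text) (n : ℕ) : List (Option ℕ) := lockApprox h (T.initSeg n) n

variable {h} {T : Text}

theorem lockApprox_initSeg {n m : ℕ} (hnm : n ≤ m) :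
    lockApprox h (T.initSeg m) n = lockSeq h T n := by
  induction n generalizing m with
  | zero => rfl
  | succ n ih =>
    rw [lockSeq, lockApprox, lockApprox, ih (by omega), ih (by omega), T.take_initSeg hnm,
      T.take_initSeg le_rfl]

theorem lockSeq_succ (n : ℕ) : lockSeq h T (n + 1) =
    if Refutes h n (lockSeq h T n) (T.initSeg (n + 1)) then
      lockSeq h T n ++ (candidate n ++ T.initSeg (n + 1))
    else lockSeq h T n := by
  rw [lockSeq, lockApprox, lockApprox_initSeg (Nat.le_succ n), T.take_initSeg le_rfl]

theorem refutes_of_lockSeq_ne {n : ℕ} (hn : lockSeq h T (n + 1) ≠ lockSeq h T n) :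
    Refutes h n (lockSeq h T n) (T.initSeg (n + 1)) := by
  by_contra hc
  exact hn (by rw [lockSeq_succ, if_neg hc])

theorem lockSeq_succ_of_refutes {n : ℕ}
    (hn : Refutes h n (lockSeq h T n) (T.initSeg (n + 1))) :
    lockSeq h T (n + 1) = lockSeq h T n ++ (candidate n ++ T.initSeg (n + 1)) := by
  rw [lockSeq_succ, if_pos hn]

theorem lockSeq_prefix {m n : ℕ} (hmn : m ≤ n) : lockSeq h T m <+: lockSeq h T n := by
  induction n, hmn using Nat.le_induction with
  | base => exact List.prefix_rfl
  | succ n _ ih =>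
    refine ih.trans ?_
    rw [lockSeq_succ]
    split_ifs
    · exact List.prefix_append _ _
    · exact List.prefix_rfl

/-- Approximations only grow under the prefix order, so an abandoned one never returns. -/
theorem lockSeq_eq_of_le_of_le {i j k : ℕ} (hij : i ≤ j) (hjk : j ≤ k)
    (hik : lockSeq h T i = lockSeq h T k) : lockSeq h T j = lockSeq h T i := by
  have h₁ : lockSeq h T j <+: lockSeq h T i := hik ▸ lockSeq_prefix hjk
  exact h₁.eq_of_length_le (lockSeq_prefix hij).length_le

theorem mem_content_of_mem_lockSeq {n x : ℕ} (hx : some x ∈ lockSeq h T n) : x ∈ T.content := by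
  induction n with
  | zero => simp [lockSeq, lockApprox] at hx
  | succ n ih =>
    by_cases hr : Refutes h n (lockSeq h T n) (T.initSeg (n + 1))
    · rw [lockSeq_succ_of_refutes hr, List.mem_append, List.mem_append] at hx
      rcases hx with hx | hx | hx
      · exact ih hx
      · exact Text.mem_content_of_mem_initSeg (covered_iff.1 hr.1 x hx)
      · exact Text.mem_content_of_mem_initSeg hx
    · rw [lockSeq_succ, if_neg hr] at hx
      exact ih hx

/-- An approximation is given up only if the data in a later one refute it. -/
theorem exists_refutation {i k : ℕ} (hik : i ≤ k) (hne : lockSeq h T i ≠ lockSeq h T k) :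
    ∃ ρ, h (lockSeq h T i ++ ρ) ≠ h (lockSeq h T i) ∧ Covered ρ (lockSeq h T k) := by
  induction k, hik using Nat.le_induction with
  | base => exact absurd rfl hne
  | succ k hik ih =>
    by_cases hc : lockSeq h T i = lockSeq h T k
    · have hr := refutes_of_lockSeq_ne (hc ▸ hne.symm)
      refine ⟨candidate k, hc ▸ hr.2, covered_iff.2 fun x hx => ?_⟩
      rw [lockSeq_succ_of_refutes hr]
      simp [hx]
    · obtain ⟨ρ, h₁, h₂⟩ := ih hc
      exact ⟨ρ, h₁, covered_iff.2 fun x hx =>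
        (lockSeq_prefix (Nat.le_succ k)).subset (covered_iff.1 h₂ x hx)⟩

/-- If `h` converges on all texts for the content of `T`, then so does the search. -/
theorem lockSeq_converges
    (hT : ∀ T' : Text, T'.content = T.content →
      ∃ n₀, ∀ n ≥ n₀, h (T'.initSeg n) = h (T'.initSeg n₀)) :
    ∃ n₀, ∀ n ≥ n₀, lockSeq h T n = lockSeq h T n₀ := by
  by_contra! hne
  have hch : ∀ n₀, ∃ n ≥ n₀, Refutes h n (lockSeq h T n) (T.initSeg (n + 1)) := by
    intro n₀
    by_contra! hc
    obtain ⟨n, hn, hn'⟩ := hne n₀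
    refine hn' ?_
    induction n, hn using Nat.le_induction with
    | base => rfl
    | succ n hn ih =>
      rw [lockSeq_succ, if_neg (hc n hn)]
      by_contra h'
      exact h' (ih h')
  have hlen : ∀ m, ∃ n, m ≤ (lockSeq h T n).length := by
    intro m
    obtain ⟨n, hn, hr⟩ := hch m
    refine ⟨n + 1, ?_⟩
    rw [lockSeq_succ_of_refutes hr]
    simp only [List.length_append, Text.length_initSeg]
    omega
  choose N hN using fun m => hlen (m + 1)
  -- The limit of the growing approximations, a text on which `h` would change its mind infinitely
  -- often.
  let T' : Text := fun m => (lockSeq h T (N m))[m]'(hN m)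
  have hget : ∀ n m (hm : m < (lockSeq h T n).length), (lockSeq h T n)[m] = T' m := by
    intro n m hm
    rcases le_total n (N m) with hle | hle
    · exact (lockSeq_prefix hle).getElem hm
    · exact ((lockSeq_prefix hle).getElem (hN m)).symm
  have hpre : ∀ n τ, τ <+: lockSeq h T n → T'.initSeg τ.length = τ := by
    intro n τ hτ
    apply List.ext_getElem
    · simp
    · intro i h₁ h₂
      rw [hτ.getElem h₂, hget]
      simp [Text.initSeg]
  have hcont : T'.content = T.content := by
    ext x
    constructor
    · rintro ⟨m, hm⟩
      exact mem_content_of_mem_lockSeq (h := h) (n := N m) (hm ▸ List.getElem_mem _)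
    · rintro ⟨i, hi⟩
      obtain ⟨n, hn, hr⟩ := hch i
      have hx : some x ∈ lockSeq h T (n + 1) := by
        rw [lockSeq_succ_of_refutes hr]
        simp only [List.mem_append]
        exact Or.inr (Or.inr (Text.mem_initSeg.2 ⟨i, by omega, hi⟩))
      obtain ⟨m, hm, hmx⟩ := List.getElem_of_mem hx
      exact ⟨m, by rw [← hget _ m hm, hmx]⟩
  obtain ⟨n₀, hn₀⟩ := hT T' hcont
  obtain ⟨n₁, hn₁⟩ := hlen n₀
  obtain ⟨n, hn, hr⟩ := hch n₁
  have hl : n₀ ≤ (lockSeq h T n).length := hn₁.trans (lockSeq_prefix hn).length_le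
  have e₁ := hn₀ _ hl
  -- Both the approximation and its extension by the refuting candidate are initial segments of `T'`
  -- beyond the point of convergence.
  have e₂ := hn₀ (lockSeq h T n ++ candidate n).length (by rw [List.length_append]; omega)
  rw [hpre n _ List.prefix_rfl] at e₁
  rw [hpre (n + 1)] at e₂
  · exact hr.2 (e₂.trans e₁.symm)
  · rw [lockSeq_succ_of_refutes hr, ← List.append_assoc]
    exact List.prefix_append _ _

/-- If the search converges, then its limit is not refuted by any data of the text. -/
theorem lock_of_converges {n₀ : ℕ} (hn₀ : ∀ n ≥ n₀, lockSeq h T n = lockSeq h T n₀)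
    {ρ : List (Option ℕ)} (hρ : ∀ x, some x ∈ ρ → x ∈ T.content) :
    h (lockSeq h T n₀ ++ ρ) = h (lockSeq h T n₀) := by
  obtain ⟨s₀, hs₀⟩ := eventually_covered (A := fun n => T.initSeg (n + 1)) (ρ := ρ)
    (fun s t hst x hx => by
      obtain ⟨i, hi, hix⟩ := Text.mem_initSeg.1 hx
      exact Text.mem_initSeg.2 ⟨i, by omega, hix⟩)
    (fun x hx => by
      obtain ⟨i, hi⟩ := hρ x hx
      exact ⟨i, Text.mem_initSeg.2 ⟨i, by omega, hi⟩⟩)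
  obtain ⟨n, hn, rfl⟩ := exists_candidate_eq ρ (max n₀ s₀)
  by_contra hc
  have hle : n₀ ≤ n := (le_max_left _ _).trans hn
  have hr : Refutes h n (lockSeq h T n) (T.initSeg (n + 1)) :=
    ⟨hs₀ n ((le_max_right _ _).trans hn), by rwa [hn₀ n hle]⟩
  -- A refutation appends at least `n + 1` entries, whereas the approximation no longer changes.
  have e := congrArg List.length (lockSeq_succ_of_refutes hr)
  rw [hn₀ n hle, hn₀ (n + 1) (by omega)] at e
  simp only [List.length_append, Text.length_initSeg] at e
  omega

/-- A total learner that learns the content of `T` has a locking sequence for it, and the search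
finds one. -/
theorem exists_lockSeq_locking {φ : ℕ → ℕ →. ℕ}
    (hT : ∀ T' : Text, T'.content = T.content →
      ∃ n₀, ∀ n ≥ n₀, h (T'.initSeg n) = h (T'.initSeg n₀) ∧
        W φ (h (T'.initSeg n₀)) = T'.content) :
    ∃ n₀, (∀ n ≥ n₀, lockSeq h T n = lockSeq h T n₀) ∧
      (∀ ρ, (∀ x, some x ∈ ρ → x ∈ T.content) →
        h (lockSeq h T n₀ ++ ρ) = h (lockSeq h T n₀)) ∧
      W φ (h (lockSeq h T n₀)) = T.content := by
  obtain ⟨n₀, hn₀⟩ := lockSeq_converges fun T' hT' =>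
    (hT T' hT').imp fun _ H n hn => (H n hn).1
  refine ⟨n₀, hn₀, fun ρ => lock_of_converges hn₀, ?_⟩
  -- On this text `h` never leaves its value at the limit, so that value must be correct.
  have hc : (Text.prepend (lockSeq h T n₀) T).content = T.content :=
    Text.content_prepend fun x => mem_content_of_mem_lockSeq
  obtain ⟨m, hm⟩ := hT _ hc
  rw [← hc, ← (hm m le_rfl).2, ← (hm ((lockSeq h T n₀).length + m) (by omega)).1,
    Text.initSeg_prepend, lock_of_converges hn₀]
  intro x
  exact Text.mem_content_of_mem_initSeg

end Search

/-! ### Poisoned enumerations -/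

/-- The partial function whose domain is enumerated by `A`, until `bad` first holds at a stage `s`;
from then on it is replaced by the initial segment up to `K s`. -/
def poison (bad : ℕ → Bool) (A : ℕ → ℕ → Bool) (K : ℕ → ℕ) (x : ℕ) : Part ℕ :=
  (Nat.rfind ((fun s => bad s || A s x : ℕ → Bool) : ℕ →. Bool)).bind fun s =>
    bif bad s && decide (K s < x) then Part.none else Part.some 0

theorem poison_dom_of_not_bad {bad : ℕ → Bool} {A : ℕ → ℕ → Bool} {K : ℕ → ℕ}
    (hbad : ∀ s, bad s = false) (x : ℕ) : (poison bad A K x).Dom ↔ ∃ s, A s x = true := by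
  have : (poison bad A K x).Dom ↔
      (Nat.rfind ((fun s => bad s || A s x : ℕ → Bool) : ℕ →. Bool)).Dom := by
    simp [poison, hbad, Part.bind_dom]
  rw [this, Nat.rfind_dom]
  constructor
  · rintro ⟨s, hs, -⟩
    exact ⟨s, by simpa [hbad] using hs⟩
  · rintro ⟨s, hs⟩
    exact ⟨s, by simpa [hbad] using hs, fun _ => trivial⟩

/-- Whatever is enumerated before the first bad stage already lies below the bound `K` of that
stage, so the final set is exactly an initial segment. -/
theorem exists_poison_dom_iff_le {bad : ℕ → Bool} {A : ℕ → ℕ → Bool} {K : ℕ → ℕ}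
    (hbad : ∃ s, bad s = true) (hA : ∀ s t x, s ≤ t → A s x = true → x ≤ K t) :
    ∃ s, ∀ x, (poison bad A K x).Dom ↔ x ≤ K s := by
  classical
  refine ⟨Nat.find hbad, fun x => ?_⟩
  obtain ⟨s, hs, hle⟩ := Nat.rfind_min' (p := fun s => bad s || A s x) (m := Nat.find hbad)
    (by simp [Nat.find_spec hbad])
  have e : poison bad A K x = bif bad s && decide (K s < x) then Part.none else Part.some 0 := by
    rw [poison, Part.eq_some_iff.2 hs, Part.bind_some]
  rw [e]
  rcases Bool.eq_false_or_eq_true (bad s) with hb | hb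
  · have : s = Nat.find hbad := le_antisymm hle (Nat.find_min' _ hb)
    subst this
    by_cases hx : K (Nat.find hbad) < x
    · simp [hb, hx]
    · simp [hb, hx, not_lt.1 hx]
  · have hAs : A s x = true := by simpa [hb] using Nat.rfind_spec hs
    simp [hb, hA s _ x hle hAs]


/-! ### Computability -/

theorem primrecRel_covered : PrimrecRel Covered := by
  have hmem : PrimrecRel fun (a : Option ℕ) (l : List (Option ℕ)) => a ∈ l :=
    (((Primrec.eq (α := Option ℕ)).exists_mem_list).comp Primrec.snd Primrec.fst).of_eq
      fun p => by simp
  have hR : PrimrecRel fun (a : Option ℕ) (l : List (Option ℕ)) => a = none ∨ a ∈ l :=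
    PrimrecPred.or (Primrec.eq.comp Primrec.fst (Primrec.const none)) hmem
  exact hR.forall_mem_list

theorem primrec_candidate : Primrec candidate :=
  Primrec.option_getD.comp
    (Primrec.decode.comp (Primrec.fst.comp Primrec.unpair)) (Primrec.const [])

theorem computable_covered {α : Type*} [Primcodable α] {f g : α → List (Option ℕ)}
    (hf : Computable f) (hg : Computable g) : Computable fun a => decide (Covered (f a) (g a)) :=
  primrecRel_covered.decide.to_comp.comp hf hg

theorem computable_refutes {h : List (Option ℕ) → ℕ} (hh : Computable h) {α : Type*}
    [Primcodable α] {n : α → ℕ} {f g : α → List (Option ℕ)} (hn : Computable n)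
    (hf : Computable f) (hg : Computable g) :
    Computable fun a => decide (Refutes h (n a) (f a) (g a)) := by
  have hc : Computable fun a => candidate (n a) := primrec_candidate.to_comp.comp hn
  have hne : Computable fun a => !decide (h (f a ++ candidate (n a)) = h (f a)) :=
    Primrec.not.to_comp.comp (Primrec.eq.decide.to_comp.comp
      (hh.comp (Computable.list_append.comp hf hc)) (hh.comp hf))
  exact (Primrec.and.to_comp.comp (computable_covered hc hg) hne).of_eq fun a => by
    rw [Bool.eq_iff_iff, decide_eq_true_iff]
    simp [Refutes]

theorem computable_lockApprox {h : List (Option ℕ) → ℕ} (hh : Computable h) :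
    Computable fun l => lockApprox h l l.length := by
  have hn : Computable fun p : List (Option ℕ) × ℕ × List (Option ℕ) => p.2.1 :=
    Computable.fst.comp Computable.snd
  have hs : Computable fun p : List (Option ℕ) × ℕ × List (Option ℕ) => p.2.2 :=
    Computable.snd.comp Computable.snd
  have ht : Computable fun p : List (Option ℕ) × ℕ × List (Option ℕ) => p.1.take (p.2.1 + 1) :=
    Primrec.list_take.to_comp.comp (Computable.succ.comp hn) Computable.fst
  have step : Computable₂ fun (l : List (Option ℕ)) (p : ℕ × List (Option ℕ)) =>
      bif decide (Refutes h p.1 p.2 (l.take (p.1 + 1))) then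
        p.2 ++ (candidate p.1 ++ l.take (p.1 + 1)) else p.2 :=
    Computable.cond (computable_refutes hh hn hs ht)
      (Computable.list_append.comp hs
        (Computable.list_append.comp (primrec_candidate.to_comp.comp hn) ht)) hs
  refine (Computable.nat_rec Computable.list_length (Computable.const []) step).of_eq fun l => ?_
  induction l.length with
  | zero => rfl
  | succ n ih =>
    rw [lockApprox, ← ih, ← Bool.cond_decide]

/-- A uniformly computable, increasing enumeration of the sets `content σ ∪ W e`. -/
theorem exists_enumeration {φ : ℕ → ℕ →. ℕ} (hφ : Partrec₂ φ) :
    ∃ E : List (Option ℕ) × ℕ → ℕ → List (Option ℕ), Computable₂ E ∧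
      (∀ p s t x, s ≤ t → some x ∈ E p s → some x ∈ E p t) ∧
      (∀ p s x, some x ∈ E p s → x < s) ∧
      ∀ p x, (∃ s, some x ∈ E p s) ↔ some x ∈ p.1 ∨ x ∈ W φ p.2 := by
  have hφ' : Nat.Partrec fun n => φ n.unpair.1 n.unpair.2 :=
    Partrec.nat_iff.1 (Partrec₂.unpaired.2 hφ)
  obtain ⟨c, hc⟩ := Nat.Partrec.Code.exists_code.1 hφ'
  have hW : ∀ e x, x ∈ W φ e ↔ ∃ s, (c.evaln s (Nat.pair e x)).isSome := by
    intro e x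
    have : x ∈ W φ e ↔ (c.eval (Nat.pair e x)).Dom := by simp [hc, W]
    rw [this, Part.dom_iff_mem]
    simp only [Nat.Partrec.Code.evaln_complete, Option.isSome_iff_exists, Option.mem_def]
    exact exists_comm
  let Q : ((List (Option ℕ) × ℕ) × ℕ) → ℕ → Prop := fun p x =>
    Covered [some x] p.1.1 ∨ (c.evaln p.2 (Nat.pair p.1.2 x)).isSome = true
  have hQdec : ∀ p x, Decidable (Q p x) := fun p x => inferInstanceAs (Decidable (_ ∨ _))
  have hQiff : ∀ p s x, Q (p, s) x ↔ some x ∈ p.1 ∨ (c.evaln s (Nat.pair p.2 x)).isSome = true := by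
    intro p s x
    simp [Q, Covered]
  have hQ : PrimrecRel Q := by
    refine PrimrecPred.or ?_ ?_
    · exact primrecRel_covered.comp
        (Primrec.list_cons.comp (Primrec.option_some.comp Primrec.snd) (Primrec.const []))
        (Primrec.fst.comp (Primrec.fst.comp Primrec.fst))
    · have hev : Primrec fun a : ((List (Option ℕ) × ℕ) × ℕ) × ℕ =>
          c.evaln a.1.2 (Nat.pair a.1.1.2 a.2) :=
        Nat.Partrec.Code.primrec_evaln.comp
          (Primrec.pair (Primrec.pair (Primrec.snd.comp Primrec.fst) (Primrec.const c))
            (Primrec₂.natPair.comp (Primrec.snd.comp (Primrec.fst.comp Primrec.fst)) Primrec.snd))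
      exact Primrec.eq.comp (Primrec.option_isSome.comp hev) (Primrec.const true)
  have hE : Primrec fun p : (List (Option ℕ) × ℕ) × ℕ =>
      (List.range p.2).map fun x => if Q p x then some x else none :=
    Primrec.list_map (Primrec.list_range.comp Primrec.snd)
      (Primrec.ite hQ (Primrec.option_some.comp Primrec.snd) (Primrec.const none))
  have hmem : ∀ p s x, some x ∈ ((List.range s).map fun x => if Q (p, s) x then some x else none) ↔
      x < s ∧ Q (p, s) x := by
    intro p s x
    simp only [List.mem_map, List.mem_range]
    constructor
    · rintro ⟨y, hy, he⟩
      split_ifs at he with hq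
      cases he
      exact ⟨hy, hq⟩
    · rintro ⟨hx, hq⟩
      exact ⟨x, hx, if_pos hq⟩
  have hmono : ∀ p s t x, s ≤ t → Q (p, s) x → Q (p, t) x := by
    intro p s t x hst
    rw [hQiff, hQiff]
    refine Or.imp_right fun hs => ?_
    obtain ⟨y, hy⟩ := Option.isSome_iff_exists.1 hs
    exact Option.isSome_iff_exists.2 ⟨y, Nat.Partrec.Code.evaln_mono hst hy⟩
  refine ⟨fun p s => (List.range s).map fun x => if Q (p, s) x then some x else none,
    hE.to_comp, ?_, ?_, ?_⟩
  · intro p s t x hst hx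
    rw [hmem] at hx ⊢
    exact ⟨hx.1.trans_le hst, hmono p s t x hst hx.2⟩
  · intro p s x hx
    exact ((hmem p s x).1 hx).1
  · intro p x
    rw [hW, exists_congr fun s => (hmem p s x).trans (and_congr_right' (hQiff p s x))]
    constructor
    · rintro ⟨s, -, hs⟩
      exact hs.imp_right fun hs => ⟨s, hs⟩
    · rintro (hx | ⟨s, hs⟩)
      -- Stage `s` lists only numbers below `s`.
      · exact ⟨x + 1, Nat.lt_succ_self x, Or.inl hx⟩
      · refine ⟨max s (x + 1), by omega, ?_⟩
        rw [← hQiff]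
        exact hmono p s _ x (le_max_left _ _) ((hQiff p s x).2 (Or.inr hs))

theorem partrec_poison {α : Type*} [Primcodable α] {bad : α → ℕ → Bool} {A : α → ℕ → ℕ → Bool}
    {K : α → ℕ → ℕ} (hbad : Computable₂ bad)
    (hA : Computable fun p : (α × ℕ) × ℕ => A p.1.1 p.2 p.1.2) (hK : Computable₂ K) :
    Partrec₂ fun (a : α) (x : ℕ) => poison (bad a) (A a) (K a) x := by
  have h₁ : Computable₂ fun (p : α × ℕ) (s : ℕ) => bad p.1 s || A p.1 s p.2 :=
    Primrec.or.to_comp.comp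
      (hbad.comp (Computable.fst.comp Computable.fst) Computable.snd) hA
  have h₂ : Computable₂ fun (p : α × ℕ) (s : ℕ) => bad p.1 s && decide (K p.1 s < p.2) :=
    Primrec.and.to_comp.comp (hbad.comp (Computable.fst.comp Computable.fst) Computable.snd)
      (Primrec.nat_lt.decide.to_comp.comp
        (hK.comp (Computable.fst.comp Computable.fst) Computable.snd)
        (Computable.snd.comp Computable.fst))
  exact (Partrec.rfind h₁.partrec₂).bind
    (Partrec.cond h₂ Partrec.none (Computable.const 0).partrec)

/-! ### The strongly decisive learner -/

/-- Conjectures for finite sequences `σ` that are correct if `σ` is a locking sequence not covering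
`σ₀`, and that are spoiled, differently for each `σ`, if `σ` is refuted by the conjecture or if the
conjecture covers `σ₀`. -/
theorem exists_conjectures {φ : ℕ → ℕ →. ℕ} (hφ : IsAcceptable φ) {h : List (Option ℕ) → ℕ}
    (hh : Computable h) (σ₀ : List (Option ℕ)) :
    ∃ p : List (Option ℕ) → ℕ, Computable p ∧ ∃ spoiled : List (Option ℕ) → Prop,
      (∀ σ, ¬ spoiled σ → W φ (p σ) = {x | some x ∈ σ} ∪ W φ (h σ)) ∧
      (∀ σ, spoiled σ → (W φ (p σ)).Finite ∧ ∀ x, some x ∈ σ₀ → x ∈ W φ (p σ)) ∧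
      (∀ σ τ, spoiled σ → spoiled τ → W φ (p σ) = W φ (p τ) → σ = τ) ∧
      (∀ σ, spoiled σ ↔ (∀ x, some x ∈ σ₀ → some x ∈ σ ∨ x ∈ W φ (h σ)) ∨
        ∃ ρ, (∀ x, some x ∈ ρ → some x ∈ σ ∨ x ∈ W φ (h σ)) ∧ h (σ ++ ρ) ≠ h σ) := by
  obtain ⟨E, hE, hmono, hlt, hmem⟩ := exists_enumeration hφ.1
  obtain ⟨C, hC⟩ : ∃ C, ∀ x, some x ∈ σ₀ → x ≤ C := by
    refine ⟨(σ₀.map fun a => a.getD 0).sum, fun x hx => ?_⟩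
    exact List.le_sum_of_mem (List.mem_map.2 ⟨some x, hx, rfl⟩)
  let A : List (Option ℕ) → ℕ → List (Option ℕ) := fun σ s => E (σ, h σ) s
  let bad : List (Option ℕ) → ℕ → Bool := fun σ s =>
    decide (Covered σ₀ (A σ s)) || decide (Refutes h s σ (A σ s))
  -- `C` keeps the data of `σ₀` inside, the code of `σ` separates spoiled sets, and the pair is at
  -- least `s`, hence bounds all data listed by stage `s`.
  let K : List (Option ℕ) → ℕ → ℕ := fun σ s => C + Nat.pair (Encodable.encode σ) s
  let ψ : List (Option ℕ) → ℕ →. ℕ := fun σ x =>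
    poison (bad σ) (fun s x => decide (Covered [some x] (A σ s))) (K σ) x
  have hA : Computable₂ A :=
    hE.comp (Computable.pair Computable.fst (hh.comp Computable.fst)) Computable.snd
  have hψ : Partrec₂ ψ := by
    refine partrec_poison ?_ ?_ ?_
    · exact Primrec.or.to_comp.comp (computable_covered (Computable.const σ₀) hA)
        (computable_refutes hh Computable.snd Computable.fst hA)
    · exact computable_covered
        (Computable.list_cons.comp (Computable.option_some.comp
          (Computable.snd.comp Computable.fst)) (Computable.const []))
        (hA.comp (Computable.fst.comp Computable.fst) Computable.snd)
    · exact Primrec.nat_add.to_comp.comp (Computable.const C)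
        (Primrec₂.natPair.to_comp.comp (Computable.encode.comp Computable.fst) Computable.snd)
  obtain ⟨t, ht, hteq⟩ := hφ.2
    (fun e x => ψ ((Encodable.decode (α := List (Option ℕ)) e).getD []) x)
    (hψ.comp (Computable.option_getD (Computable.decode.comp Computable.fst)
      (Computable.const [])) Computable.snd)
  have hp : ∀ σ x, x ∈ W φ (t (Encodable.encode σ)) ↔ (ψ σ x).Dom := by
    intro σ x
    simp [W, hteq]
  have hsp : ∀ σ, (∃ s, bad σ s = true) →
      ∃ s, ∀ x, x ∈ W φ (t (Encodable.encode σ)) ↔ x ≤ K σ s := by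
    intro σ hb
    simp only [hp]
    refine exists_poison_dom_iff_le hb fun s t x hst hx => ?_
    have hx' : some x ∈ A σ s := by simpa [Covered] using hx
    exact (hlt _ _ _ hx').le.trans (hst.trans
      ((Nat.right_le_pair _ _).trans (Nat.le_add_left _ _)))
  refine ⟨fun σ => t (Encodable.encode σ), ht.comp Computable.encode,
    fun σ => ∃ s, bad σ s = true, ?_, ?_, ?_, ?_⟩
  · intro σ hb
    ext x
    rw [hp, poison_dom_of_not_bad (by simpa using hb)]
    simpa [Covered, A] using hmem (σ, h σ) x
  · intro σ hb
    obtain ⟨s, hs⟩ := hsp σ hb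
    exact ⟨(Set.finite_Iic (K σ s)).subset fun x hx => (hs x).1 hx,
      fun x hx => (hs x).2 ((hC x hx).trans (Nat.le_add_right _ _))⟩
  · intro σ τ hσ hτ heq
    obtain ⟨s, hs⟩ := hsp σ hσ
    obtain ⟨s', hs'⟩ := hsp τ hτ
    -- Equal initial segments have equal maxima.
    have e : K σ s = K τ s' := le_antisymm ((hs' _).1 (heq ▸ (hs _).2 le_rfl))
      ((hs _).1 (heq ▸ (hs' _).2 le_rfl))
    have e' := Nat.add_left_cancel e
    exact Encodable.encode_injective (Nat.pair_eq_pair.1 e').1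
  · intro σ
    have hcov : ∀ ρ, (∀ x, some x ∈ ρ → some x ∈ σ ∨ x ∈ W φ (h σ)) →
        ∃ s₀, ∀ s ≥ s₀, Covered ρ (A σ s) := fun ρ hρ =>
      eventually_covered (fun s t hst x => hmono _ s t x hst)
        fun x hx => (hmem (σ, h σ) x).2 (hρ x hx)
    have hcov' : ∀ ρ s, Covered ρ (A σ s) → ∀ x, some x ∈ ρ → some x ∈ σ ∨ x ∈ W φ (h σ) :=
      fun ρ s hρ x hx => (hmem (σ, h σ) x).1 ⟨s, covered_iff.1 hρ x hx⟩
    simp only [bad, Bool.or_eq_true, decide_eq_true_eq]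
    constructor
    · rintro ⟨s, hs | hs⟩
      · exact Or.inl (hcov' _ s hs)
      · exact Or.inr ⟨_, hcov' _ s hs.1, hs.2⟩
    · rintro (hs | ⟨ρ, hρ, hne⟩)
      · obtain ⟨s, hs⟩ := hcov _ hs
        exact ⟨s, Or.inl (hs s le_rfl)⟩
      · obtain ⟨s, hs⟩ := hcov _ hρ
        -- Candidate `n` is tested only at stage `n`; since `ρ` recurs, it is tested after its data
        -- have been listed.
        obtain ⟨n, hn, rfl⟩ := exists_candidate_eq ρ s
        exact ⟨n, Or.inr ⟨hs n hn, hne⟩⟩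

theorem exists_text (L : Set ℕ) : ∃ T : Text, T.content = L := by
  classical
  refine ⟨fun n => if n ∈ L then some n else none, ?_⟩
  ext x
  constructor
  · rintro ⟨n, hn⟩
    dsimp only at hn
    split_ifs at hn with h
    cases hn
    exact h
  · exact fun hx => ⟨x, if_pos hx⟩

/-- A learner of `ℕ` is total. -/
theorem exists_total_of_learns_univ {φ : ℕ → ℕ →. ℕ} {h : SeqFun} (hh : Partrec h)
    (hN : TxtGLearns (Ex φ) h Set.univ) :
    ∃ H : List (Option ℕ) → ℕ, Computable H ∧ ∀ σ, h σ = Part.some (H σ) := by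
  have hdom : ∀ σ, (h σ).Dom := by
    intro σ
    obtain ⟨T, hT⟩ := exists_text Set.univ
    have hc : (Text.prepend σ T).content = Set.univ := by
      rw [Text.content_prepend (by simp [hT]), hT]
    obtain ⟨q, hq, -⟩ := hN _ hc
    have := hq σ.length
    rw [G, Text.initSeg_prepend_length] at this
    rw [this]
    trivial
  refine ⟨fun σ => (h σ).get (hdom σ), ?_, fun σ => (Part.some_get _).symm⟩
  exact hh.of_eq fun σ => (Part.some_get _).symm

theorem ex_G_iff {φ : ℕ → ℕ →. ℕ} {h : SeqFun} {H : List (Option ℕ) → ℕ}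
    (hH : ∀ σ, h σ = Part.some (H σ)) {T : Text} :
    Ex φ (G h T) T ↔ ∃ n₀, ∀ n ≥ n₀, H (T.initSeg n) = H (T.initSeg n₀) ∧
      W φ (H (T.initSeg n₀)) = T.content := by
  simp only [Ex, G, hH]
  constructor
  · rintro ⟨q, hq, n₀, hn₀⟩
    refine ⟨n₀, ?_⟩
    simpa only [Part.some_inj.1 (hq _)] using hn₀
  · exact fun hn => ⟨_, fun _ => rfl, hn⟩

end InductiveInference

open InductiveInference in
theorem mainTheorem6 (φ : ℕ → ℕ →. ℕ) (hφ : InductiveInference.IsAcceptable φ)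
    (ℒ : Set (Set ℕ)) (hN : (Set.univ : Set ℕ) ∈ ℒ)
    (hℒ : InductiveInference.TxtGLearnable (InductiveInference.Ex φ) ℒ) :
    InductiveInference.TxtGLearnable (InductiveInference.SDecEx φ) ℒ := by
  obtain ⟨h', hh', hlearn'⟩ := hℒ
  obtain ⟨h, hh, hH⟩ := exists_total_of_learns_univ hh' (hlearn' _ hN)
  have hlearn : ∀ T : Text, T.content ∈ ℒ → ∃ n₀, ∀ n ≥ n₀,
      h (T.initSeg n) = h (T.initSeg n₀) ∧ W φ (h (T.initSeg n₀)) = T.content :=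
    fun T hT => (ex_G_iff hH).1 (hlearn' _ hT T rfl)
  obtain ⟨σ₀, hlock, hW₀⟩ : ∃ σ₀, (∀ ρ, h (σ₀ ++ ρ) = h σ₀) ∧ W φ (h σ₀) = Set.univ := by
    obtain ⟨T, hT⟩ := exists_text Set.univ
    obtain ⟨n₀, -, h₁, h₂⟩ := exists_lockSeq_locking (h := h) (φ := φ) (T := T)
      fun T' hT' => hlearn T' (by rwa [hT', hT])
    exact ⟨lockSeq h T n₀, fun ρ => h₁ ρ (by simp [hT]), h₂.trans hT⟩
  have huniv : ∀ L ∈ ℒ, (∀ x, some x ∈ σ₀ → x ∈ L) → L = Set.univ := by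
    intro L hL hsub
    obtain ⟨T, rfl⟩ := exists_text L
    have hc := Text.content_prepend hsub
    obtain ⟨m, hm⟩ := hlearn (Text.prepend σ₀ T) (by rwa [hc])
    rw [← hc, ← (hm m le_rfl).2, ← (hm (σ₀.length + m) (by omega)).1, Text.initSeg_prepend,
      hlock, hW₀]
  obtain ⟨p, hpc, spoiled, hgood, hbad, hinj, hspoiled⟩ := exists_conjectures hφ hh σ₀
  let M : List (Option ℕ) → ℕ := fun l =>
    bif decide (Covered σ₀ l) then h σ₀ else p (lockApprox h l l.length)
  have hM : Computable M :=
    Computable.cond (computable_covered (Computable.const σ₀) Computable.id)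
      (Computable.const _) (hpc.comp (computable_lockApprox hh))
  have hM₁ : ∀ T : Text, ∀ n, Covered σ₀ (T.initSeg n) → M (T.initSeg n) = h σ₀ := by
    intro T n hc
    simp [M, hc]
  have hM₂ : ∀ T : Text, ∀ n, ¬ Covered σ₀ (T.initSeg n) →
      M (T.initSeg n) = p (lockSeq h T n) := by
    intro T n hc
    simp [M, hc, lockSeq]
  have hcovmono : ∀ T : Text, ∀ i j, i ≤ j → Covered σ₀ (T.initSeg i) →
      Covered σ₀ (T.initSeg j) := by
    intro T i j hij hc
    refine covered_iff.2 fun x hx => ?_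
    obtain ⟨m, hm, hmx⟩ := Text.mem_initSeg.1 (covered_iff.1 hc x hx)
    exact Text.mem_initSeg.2 ⟨m, by omega, hmx⟩
  have hunspoiled : ∀ σ, ¬ spoiled σ → ∃ x, some x ∈ σ₀ ∧ x ∉ W φ (p σ) := by
    intro σ hσ
    by_contra! hc
    refine hσ ((hspoiled σ).2 (Or.inl fun x hx => ?_))
    simpa [hgood σ hσ] using hc x hx
  have hpuniv : ∀ σ, W φ (p σ) ≠ Set.univ := by
    intro σ he
    by_cases hσ : spoiled σ
    · exact Set.infinite_univ (he ▸ (hbad σ hσ).1)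
    · obtain ⟨x, -, hx⟩ := hunspoiled σ hσ
      exact hx (he ▸ Set.mem_univ x)
  refine ⟨fun l => Part.some (M l), hM, fun L hL T hT => ⟨⟨fun i => M (T.initSeg i),
    fun i => rfl, ?_⟩, (ex_G_iff fun σ => rfl).2 ?_⟩⟩
  · intro i j k hij hjk heq
    by_cases hi : Covered σ₀ (T.initSeg i)
    · simp only [hM₁ T i hi, hM₁ T j (hcovmono T i j hij hi)]
    by_cases hk : Covered σ₀ (T.initSeg k)
    · simp only [hM₁ T k hk, hM₂ T i hi, hW₀] at heq
      exact absurd heq (hpuniv _)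
    have hj : ¬ Covered σ₀ (T.initSeg j) := fun hc => hk (hcovmono T j k hjk hc)
    simp only [hM₂ T i hi, hM₂ T k hk] at heq
    simp only [hM₂ T i hi, hM₂ T j hj]
    -- It remains to show that equal sets at `i` and `k` come from equal approximations.
    rw [lockSeq_eq_of_le_of_le hij hjk]
    by_contra hne
    by_cases h₁ : spoiled (lockSeq h T i)
    · by_cases h₂ : spoiled (lockSeq h T k)
      · exact hne (hinj _ _ h₁ h₂ heq)
      · obtain ⟨x, hx, hxn⟩ := hunspoiled _ h₂
        exact hxn (heq ▸ (hbad _ h₁).2 x hx)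
    · by_cases h₂ : spoiled (lockSeq h T k)
      · obtain ⟨x, hx, hxn⟩ := hunspoiled _ h₁
        exact hxn (heq ▸ (hbad _ h₂).2 x hx)
      · obtain ⟨ρ, hρ, hcov⟩ := exists_refutation (hij.trans hjk) hne
        refine h₁ ((hspoiled _).2 (Or.inr ⟨ρ, fun x hx => ?_, hρ⟩))
        have hmem : x ∈ W φ (p (lockSeq h T k)) := by
          rw [hgood _ h₂]
          exact Or.inl (covered_iff.1 hcov x hx)
        rw [← heq, hgood _ h₁] at hmem
        exact hmem
  · subst hT
    by_cases hsub : ∀ x, some x ∈ σ₀ → x ∈ T.content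
    · obtain ⟨n₀, hn₀⟩ := eventually_covered (A := T.initSeg) (ρ := σ₀)
        (fun s t hst x hx => by
          obtain ⟨m, hm, hmx⟩ := Text.mem_initSeg.1 hx
          exact Text.mem_initSeg.2 ⟨m, by omega, hmx⟩)
        (fun x hx => by
          obtain ⟨i, hi⟩ := hsub x hx
          exact ⟨i + 1, Text.mem_initSeg.2 ⟨i, by omega, hi⟩⟩)
      refine ⟨n₀, fun n hn => ?_⟩
      rw [hM₁ T n (hn₀ n hn), hM₁ T n₀ (hn₀ n₀ le_rfl), hW₀, huniv _ hL hsub]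
      exact ⟨rfl, rfl⟩
    · have hnc : ∀ n, ¬ Covered σ₀ (T.initSeg n) := fun n hc =>
        hsub fun x hx => Text.mem_content_of_mem_initSeg (covered_iff.1 hc x hx)
      obtain ⟨n₀, hn₀, hl, hWl⟩ := exists_lockSeq_locking (h := h) (φ := φ) (T := T)
        fun T' hT' => hlearn T' (by rwa [hT'])
      have hcont : ∀ x, some x ∈ lockSeq h T n₀ ∨ x ∈ W φ (h (lockSeq h T n₀)) →
          x ∈ T.content := by
        rintro x (hx | hx)
        · exact mem_content_of_mem_lockSeq hx
        · exact hWl ▸ hx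
      have hns : ¬ spoiled (lockSeq h T n₀) := by
        rw [hspoiled]
        rintro (hs | ⟨ρ, hρ, hne⟩)
        · exact hsub fun x hx => hcont x (hs x hx)
        · exact hne (hl ρ fun x hx => hcont x (hρ x hx))
      refine ⟨n₀, fun n hn => ?_⟩
      rw [hM₂ T n (hnc n), hM₂ T n₀ (hnc n₀), hn₀ n hn, hgood _ hns, hWl]
      exact ⟨rfl, Set.union_eq_right.2 fun x hx => mem_content_of_mem_lockSeq hx⟩
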